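/- **Theorem.** Let $B$ and $D$ be C*-algebras, $\pi : B \to D$ a surjective $*$-homomorphism, $E \subseteq D$ a (norm-)closed subset, and $s_0 : E \to B$ a continuous section of $\pi$ over $E$, that is, a norm-continuous map (not assumed linear) with $\pi(s_0(x)) = x$ for all $x \in E$. Then there is a continuous map $s : D \to B$ with $\pi(s(x)) = x$ for all $x \in D$ and $s|_E = s_0$, which moreover has each of the following properties that $s_0$ has: 1. *contractive*: if $\|s_0(x)\| \le \|x\|$ for all $x \in E$, then $\|s(x)\| \le \|x\|$ for all $x \in D$; 2. *selfadjoint*: if $s_0(x^*) = s_0(x)^*$ whenever $x$ and $x^*$ both lie in $E$, then $s(x^*) = s(x)^*$ for all $x \in D$; 3. *positive*: if $s_0(x) \ge 0$ for all $x \in E$ with $x \ge 0$, then $s(x) \ge 0$ for all $x \in D$ with $x \ge 0$. If, in addition, $B$ and $D$ are unital (then $\pi(1) = 1$, since $\pi$ is surjective), and it is not the case that both $D = 0$ and $E = \emptyset$, then $s$ can be chosen to have, besides all of the above, also the property 4. *unital*: if $s_0(1) = 1$ or $1 \notin E$, then $s(1) = 1$. -/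

import Mathlib

/-! ### Continuous selections and right inverses of linear surjections. -/

section Selection

open Filter Set Topology

variable {X Y : Type*} [TopologicalSpace X] [NormalSpace X] [ParacompactSpace X]
  [NormedAddCommGroup Y] [NormedSpace ℝ Y]

/-! A continuous extension comes from Michael's selection theorem, applied to the set-valued map
that is the singleton of the prescribed value on `E` and the fibre of `π` elsewhere. Openness of `π`
makes it lower hemicontinuous.

The other properties come from correcting a section `σ` by continuous maps compatible with `π` that
fix what is already right. Positivity: |σ| is prescribed on the positive cone, and the result is
extended again. Contractivity: `σ x` is retracted onto the ball of radius `‖x‖` by truncating its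
modulus (`CFC.clip`). Involution: the data are first spread to E ∪ E*, then `σ x` is averaged with
σ(x*)*. In this order each correction preserves the properties already obtained. A unit outside `E`
is handled by adjoining it to `E`. -/

/-- A lower hemicontinuous map with nonempty convex values has continuous approximate
selections. -/
theorem LowerHemicontinuous.exists_continuous_mem_thickening {Φ : X → Set Y}
    (hl : LowerHemicontinuous Φ) (hc : ∀ x, Convex ℝ (Φ x)) (hne : ∀ x, (Φ x).Nonempty)
    {ε : ℝ} (hε : 0 < ε) : ∃ g : C(X, Y), ∀ x, g x ∈ Metric.thickening ε (Φ x) := by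
  refine exists_continuous_forall_mem_convex_of_local_const (fun x => (hc x).thickening ε)
    fun x => ?_
  obtain ⟨c, hcx⟩ := hne x
  refine ⟨c, (lowerHemicontinuousAt_iff.1 (hl x) (Metric.ball c ε) Metric.isOpen_ball
    ⟨c, hcx, Metric.mem_ball_self hε⟩).mono ?_⟩
  rintro y ⟨z, hz, hzc⟩
  exact Metric.mem_thickening_iff.2 ⟨z, hz, by rwa [dist_comm]⟩

/-- An approximate selection can be refined to a better one at a controlled distance. -/
theorem LowerHemicontinuous.exists_continuous_refinement {Φ : X → Set Y}
    (hl : LowerHemicontinuous Φ) (hc : ∀ x, Convex ℝ (Φ x)) {δ ε : ℝ} (hε : 0 < ε)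
    (g : C(X, Y)) (hg : ∀ x, g x ∈ Metric.thickening δ (Φ x)) :
    ∃ g' : C(X, Y), (∀ x, g' x ∈ Metric.thickening ε (Φ x)) ∧
      ∀ x, dist (g x) (g' x) ≤ δ + ε := by
  -- Moving open balls have open graph, so intersecting with them keeps `Φ` lower hemicontinuous; an
  -- `ε`-selection of the intersection is within `δ + ε` of `g`.
  have ho : HasOpenCGraph fun x => Metric.ball (g x) δ := by
    have : IsOpen {p : X × Y | dist p.2 (g p.1) < δ} :=
      isOpen_lt (continuous_snd.dist (g.continuous.comp continuous_fst)) continuous_const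
    exact this
  obtain ⟨g', hg'⟩ := (hl.inter_hasOpenCGraph ho).exists_continuous_mem_thickening
    (fun x => (hc x).inter (convex_ball _ _)) (fun x => by
      obtain ⟨z, hz, hzg⟩ := Metric.mem_thickening_iff.1 (hg x)
      exact ⟨z, hz, by rwa [Metric.mem_ball, dist_comm]⟩) hε
  refine ⟨g', fun x => Metric.thickening_subset_of_subset ε inter_subset_left (hg' x),
    fun x => ?_⟩
  obtain ⟨z, ⟨-, hz⟩, hzg⟩ := Metric.mem_thickening_iff.1 (hg' x)
  have h := dist_triangle (g x) z (g' x)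
  rw [Metric.mem_ball, dist_comm] at hz
  rw [dist_comm] at hzg
  linarith

/-- **Michael's selection theorem**. -/
theorem LowerHemicontinuous.exists_continuous_selection [CompleteSpace Y] {Φ : X → Set Y}
    (hl : LowerHemicontinuous Φ) (hc : ∀ x, Convex ℝ (Φ x)) (hne : ∀ x, (Φ x).Nonempty)
    (hcl : ∀ x, IsClosed (Φ x)) : ∃ g : C(X, Y), ∀ x, g x ∈ Φ x := by
  have hpos : ∀ n : ℕ, (0 : ℝ) < (1 / 2) ^ n := fun n => by positivity
  choose g₀ hg₀ using hl.exists_continuous_mem_thickening hc hne (hpos 0)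
  choose next hnext hdist using fun (n : ℕ)
    (g : {g : C(X, Y) // ∀ x, g x ∈ Metric.thickening ((1 / 2) ^ n) (Φ x)}) =>
    hl.exists_continuous_refinement hc (hpos (n + 1)) g.1 g.2
  let u : ∀ n : ℕ, {g : C(X, Y) // ∀ x, g x ∈ Metric.thickening ((1 / 2) ^ n) (Φ x)} :=
    fun n => Nat.rec ⟨g₀, hg₀⟩ (fun n g => ⟨next n g, hnext n g⟩) n
  have hu : ∀ x n, dist ((u n).1 x) ((u (n + 1)).1 x) ≤ 2 * (1 / 2) ^ n := fun x n => by
    have h : dist ((u n).1 x) ((u (n + 1)).1 x) ≤ (1 / 2) ^ n + (1 / 2) ^ (n + 1) :=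
      hdist n (u n) x
    refine h.trans ?_
    have := hpos n
    rw [pow_succ]
    linarith
  choose s hs using fun x => cauchySeq_tendsto_of_complete
    (cauchySeq_of_le_geometric (1 / 2) 2 (by norm_num) (hu x))
  have hlim : Tendsto (fun n : ℕ => 2 * (1 / 2 : ℝ) ^ n / (1 - 1 / 2)) atTop (𝓝 0) := by
    have := ((tendsto_pow_atTop_nhds_zero_of_lt_one (r := (1 / 2 : ℝ)) (by norm_num)
      (by norm_num)).const_mul 2).div_const (1 - 1 / 2)
    simpa using this
  -- The geometric bound does not depend on `x`, so the pointwise limits are uniform and the limit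
  -- is continuous.
  have hunif : TendstoUniformly (fun n x => (u n).1 x) s atTop := by
    rw [Metric.tendstoUniformly_iff]
    intro ε hε
    filter_upwards [hlim.eventually (gt_mem_nhds hε)] with n hn x
    rw [dist_comm]
    exact (dist_le_of_le_geometric_of_tendsto _ _ (by norm_num) (hu x) (hs x) n).trans_lt hn
  refine ⟨⟨s, hunif.continuous (Frequently.of_forall fun n => (u n).1.continuous)⟩,
    fun x => ?_⟩
  choose z hz hzu using fun n => Metric.mem_thickening_iff.1 ((u n).2 x)
  refine (hcl x).mem_of_tendsto (f := z) (b := atTop) ?_ (Eventually.of_forall hz)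
  refine (tendsto_iff_of_dist ?_).1 (hs x)
  exact squeeze_zero (fun _ => dist_nonneg) (fun n => (hzu n).le)
    (tendsto_pow_atTop_nhds_zero_of_lt_one (by norm_num) (by norm_num))

/-- **Bartle–Graves theorem**, relative version: a continuous right inverse of a surjective
continuous linear map that is given on a closed set extends to the whole space. -/
theorem ContinuousLinearMap.exists_continuous_rightInverse_eqOn {F G : Type*}
    [NormedAddCommGroup F] [NormedSpace ℝ F] [CompleteSpace F]
    [NormedAddCommGroup G] [NormedSpace ℝ G] [CompleteSpace G]
    (T : F →L[ℝ] G) (hT : Function.Surjective T) {E : Set G} (hE : IsClosed E)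
    {f : G → F} (hf : ContinuousOn f E) (hTf : ∀ x ∈ E, T (f x) = x) :
    ∃ s : G → F, Continuous s ∧ (∀ x, T (s x) = x) ∧ EqOn s f E := by
  -- The fibre over `x`, cut down to `f x` on `E`. Nearby points outside `E` are handled by the open
  -- mapping theorem; nearby points of `E` can occur only if `x ∈ E`, where `f` is continuous along
  -- `E`.
  have hl : LowerHemicontinuous fun x => {y | T y = x ∧ (x ∈ E → y = f x)} := by
    refine fun x => lowerHemicontinuousAt_iff.2 fun U hU => ?_
    rintro ⟨y, ⟨hy, hyE⟩, hyU⟩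
    have hTU : ∀ᶠ x' in 𝓝 x, x' ∈ T '' U :=
      (T.isOpenMap hT U hU).mem_nhds ⟨y, hyU, hy⟩
    have hEU : ∀ᶠ x' in 𝓝 x, x' ∈ E → f x' ∈ U := by
      by_cases hx : x ∈ E
      · exact eventually_nhdsWithin_iff.1 ((hf x hx).eventually
          (hU.mem_nhds (by rwa [← hyE hx])))
      · filter_upwards [hE.isOpen_compl.mem_nhds hx] with x' hx' h using absurd h hx'
    filter_upwards [hTU, hEU]
    rintro x' ⟨z, hzU, hz⟩ hx'
    by_cases h : x' ∈ E
    · exact ⟨f x', ⟨hTf x' h, fun _ => rfl⟩, hx' h⟩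
    · exact ⟨z, ⟨hz, fun h' => absurd h' h⟩, hzU⟩
  obtain ⟨s, hs⟩ := hl.exists_continuous_selection
    (fun x => by
      rintro y ⟨hy, hyE⟩ z ⟨hz, hzE⟩ a b - - hab
      refine ⟨?_, fun h => ?_⟩
      · rw [map_add, map_smul, map_smul, hy, hz, ← add_smul, hab, one_smul]
      · rw [hyE h, hzE h, ← add_smul, hab, one_smul])
    (fun x => by
      by_cases h : x ∈ E
      · exact ⟨f x, hTf x h, fun _ => rfl⟩
      · obtain ⟨y, hy⟩ := hT x
        exact ⟨y, hy, fun h' => absurd h' h⟩)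
    (fun x => (isClosed_eq T.continuous continuous_const).inter
      (isClosed_imp isOpen_const (isClosed_eq continuous_id continuous_const)))
  exact ⟨s, s.continuous, fun x => (hs x).1, fun x hx => (hs x).2 hx⟩

end Selection

/-! ### Truncation of the modulus by functional calculus. -/

section Clipping

namespace CFC

variable {A : Type*} [NonUnitalCStarAlgebra A] [PartialOrder A] [StarOrderedRing A]

/-- The scalar function `t ↦ 1 - 1 / max 1 t`. -/
noncomputable def clipFun (t : ℝ) : ℝ := 1 - (max 1 t)⁻¹

theorem continuous_clipFun : Continuous clipFun :=
  continuous_const.sub ((continuous_const.max continuous_id).inv₀ fun t =>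
    (zero_lt_one.trans_le (le_max_left 1 t)).ne')

theorem clipFun_of_le_one {t : ℝ} (ht : t ≤ 1) : clipFun t = 0 := by
  simp [clipFun, max_eq_left ht]

/-- For `t ≥ 0` the expression equals `t / max 1 t`, that is, `min t 1`. -/
theorem sub_mul_clipFun_mem_Icc {t : ℝ} (ht : 0 ≤ t) : t - t * clipFun t ∈ Set.Icc 0 1 := by
  have hm : 0 < max 1 t := zero_lt_one.trans_le (le_max_left 1 t)
  have h : t - t * clipFun t = t / max 1 t := by
    rw [clipFun, div_eq_mul_inv]; ring
  rw [h]
  exact ⟨by positivity, (div_le_one hm).2 (le_max_right 1 t)⟩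

/-- The retraction of a C⋆-algebra onto its closed unit ball which replaces the modulus in the
polar decomposition by its minimum with `1`. -/
noncomputable def clip (a : A) : A := a - a * cfcₙ clipFun (CFC.abs a)

/-- No polar decomposition is needed: |a| depends continuously on `a`, and so does a fixed
continuous function, vanishing at 0, of |a|. -/
theorem continuous_clip : Continuous (clip : A → A) := by
  have h : Continuous fun a : A => cfcₙ clipFun (CFC.abs a) :=
    Continuous.cfcₙ_of_mem_nhdsSet (s := Set.univ) clipFun Filter.univ_mem CFC.continuous_abs
      (fun a => (CFC.abs_nonneg a).isSelfAdjoint) continuous_clipFun.continuousOn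
      (clipFun_of_le_one zero_le_one)
  exact continuous_id.sub (continuous_id.mul h)

theorem clip_of_norm_le_one {a : A} (ha : ‖a‖ ≤ 1) : clip a = a := by
  have h : cfcₙ clipFun (CFC.abs a) = cfcₙ (fun _ : ℝ => (0 : ℝ)) (CFC.abs a) := by
    refine cfcₙ_congr fun t ht => clipFun_of_le_one ?_
    have := NonUnitalIsometricContinuousFunctionalCalculus.norm_quasispectrum_le (CFC.abs a) ht
      (CFC.abs_nonneg a).isSelfAdjoint
    rw [CFC.norm_abs] at this
    exact (le_abs_self t).trans (this.trans ha)
  rw [clip, h, cfcₙ_const_zero, mul_zero, sub_zero]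

theorem clip_eq_cfcₙ_of_nonneg {a : A} (ha : 0 ≤ a) :
    clip a = cfcₙ (fun t : ℝ => t - t * clipFun t) a := by
  have hc := continuous_clipFun
  have h0 := clipFun_of_le_one (zero_le_one (α := ℝ))
  have hsa := ha.isSelfAdjoint
  rw [clip, CFC.abs_of_nonneg a ha, cfcₙ_sub (fun t : ℝ => t) (fun t => t * clipFun t) a
    (by fun_prop) rfl (by fun_prop) (by simp), cfcₙ_mul (fun t : ℝ => t) clipFun a
    (by fun_prop) rfl (by fun_prop) h0, cfcₙ_id' ℝ a]

theorem clip_nonneg {a : A} (ha : 0 ≤ a) : 0 ≤ clip a := by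
  rw [clip_eq_cfcₙ_of_nonneg ha]
  exact cfcₙ_nonneg fun t ht => (sub_mul_clipFun_mem_Icc
    (quasispectrum_nonneg_of_nonneg a ha t ht)).1

/-- Writing `k` for the function of |a|, (clip a)*(clip a) is formally (1 - k)|a|²(1 - k), which
depends only on |a|; the C⋆-identity then gives equal norms. -/
theorem norm_clip_abs (a : A) : ‖clip (CFC.abs a)‖ = ‖clip a‖ := by
  have hk : star (cfcₙ clipFun (CFC.abs a)) = cfcₙ clipFun (CFC.abs a) :=
    (cfcₙ_predicate clipFun (CFC.abs a) : IsSelfAdjoint _).star_eq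
  have ha : star (CFC.abs a) = CFC.abs a := (CFC.abs_nonneg a).isSelfAdjoint.star_eq
  have hsq := CFC.abs_mul_abs a
  have h : star (clip (CFC.abs a)) * clip (CFC.abs a) = star (clip a) * clip a := by
    rw [clip, clip, CFC.abs_of_nonneg _ (CFC.abs_nonneg a)]
    simp only [star_sub, star_mul, hk, ha, sub_mul, mul_sub, mul_assoc]
    simp only [← mul_assoc (star a), ← hsq, mul_assoc]
  rw [← sq_eq_sq₀ (norm_nonneg _) (norm_nonneg _), sq, sq, ← CStarRing.norm_star_mul_self, h,
    CStarRing.norm_star_mul_self]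

theorem norm_clip_le_one (a : A) : ‖clip a‖ ≤ 1 := by
  rw [← norm_clip_abs, clip_eq_cfcₙ_of_nonneg (CFC.abs_nonneg a)]
  refine norm_cfcₙ_le fun t ht => ?_
  have := sub_mul_clipFun_mem_Icc
    (quasispectrum_nonneg_of_nonneg _ (CFC.abs_nonneg a) t ht)
  rw [Real.norm_of_nonneg this.1]
  exact this.2

end CFC

end Clipping

/-! ### Sections of surjective ⋆-homomorphisms. -/

namespace NonUnitalStarAlgHom

open Set

variable {B D : Type*}
  [NonUnitalCStarAlgebra B] [PartialOrder B] [StarOrderedRing B]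
  [NonUnitalCStarAlgebra D] [PartialOrder D] [StarOrderedRing D]

/-- The image of |b| is a positive square root of π(b)*π(b), and such a root is unique. -/
theorem map_cfcAbs (π : B →⋆ₙₐ[ℂ] D) (b : B) : π (CFC.abs b) = CFC.abs (π b) := by
  refine (CFC.sqrt_unique ?_ (map_nonneg π (CFC.abs_nonneg b))).symm
  rw [← map_mul, CFC.abs_mul_abs, map_mul, map_star]

theorem map_cfcClip (π : B →⋆ₙₐ[ℂ] D) (b : B) : π (CFC.clip b) = CFC.clip (π b) := by
  have h := map_cfcₙ (R := ℝ) π CFC.clipFun (CFC.abs b) CFC.continuous_clipFun.continuousOn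
    (CFC.clipFun_of_le_one zero_le_one) (map_continuous π) (CFC.abs_nonneg b).isSelfAdjoint
    (map_nonneg π (CFC.abs_nonneg b)).isSelfAdjoint
  rw [CFC.clip, CFC.clip, map_sub, map_mul, h, map_cfcAbs]

/-- A partial continuous section on a closed set extends to a continuous section. -/
theorem exists_continuous_section_eqOn (π : B →⋆ₙₐ[ℂ] D) (hπ : Function.Surjective π)
    {E : Set D} (hE : IsClosed E) {f : D → B} (hf : ContinuousOn f E)
    (hπf : ∀ x ∈ E, π (f x) = x) :
    ∃ s : D → B, Continuous s ∧ (∀ x, π (s x) = x) ∧ EqOn s f E :=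
  ContinuousLinearMap.exists_continuous_rightInverse_eqOn
    (⟨{ toFun := π
        map_add' := map_add π
        map_smul' := fun r b => by
          simpa only [Complex.coe_smul, RingHom.id_apply] using map_smul π (r : ℂ) b },
      map_continuous π⟩ : B →L[ℝ] D) hπ hE hf hπf

/-- A partial continuous section that is positive on a closed set extends to a positive continuous
section. -/
theorem exists_continuous_section_eqOn_nonneg (π : B →⋆ₙₐ[ℂ] D) (hπ : Function.Surjective π)
    {E : Set D} (hE : IsClosed E) {f : D → B} (hf : ContinuousOn f E)
    (hπf : ∀ x ∈ E, π (f x) = x) (hf₀ : ∀ x ∈ E, 0 ≤ x → 0 ≤ f x) :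
    ∃ s : D → B, Continuous s ∧ (∀ x, π (s x) = x) ∧ EqOn s f E ∧ ∀ x, 0 ≤ x → 0 ≤ s x := by
  classical
  obtain ⟨σ, hσ, hπσ, hσf⟩ := exists_continuous_section_eqOn π hπ hE hf hπf
  -- On the positive cone |σ| is again a section, and it agrees with `f` on `E` because `f` is
  -- positive there.
  let g : D → B := fun x => if 0 ≤ x then CFC.abs (σ x) else f x
  have hgf : EqOn g f E := fun x hx => by
    by_cases h : 0 ≤ x
    · simp only [g, if_pos h, hσf hx, CFC.abs_of_nonneg _ (hf₀ x hx h)]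
    · simp only [g, if_neg h]
  have hgσ : EqOn g (fun x => CFC.abs (σ x)) {x | 0 ≤ x} := fun x hx => if_pos hx
  have hP : IsClosed {x : D | 0 ≤ x} := CStarAlgebra.isClosed_nonneg
  obtain ⟨s, hs, hπs, hsg⟩ := exists_continuous_section_eqOn π hπ (hE.union hP)
    ((hf.congr hgf).union_of_isClosed
      ((CFC.continuous_abs.comp hσ).continuousOn.congr hgσ) hE hP) (by
      rintro x (hx | hx)
      · rw [hgf hx, hπf x hx]
      · rw [hgσ hx, map_cfcAbs, hπσ, CFC.abs_of_nonneg x hx])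
  refine ⟨s, hs, hπs, fun x hx => (hsg (Or.inl hx)).trans (hgf hx), fun x hx => ?_⟩
  rw [hsg (Or.inr hx), hgσ hx]
  exact CFC.abs_nonneg _

/-- Any continuous section can be made contractive, without changing it where it is contractive
already and preserving its positivity. -/
theorem exists_contractive_section (π : B →⋆ₙₐ[ℂ] D) {σ : D → B} (hσ : Continuous σ)
    (hπσ : ∀ x, π (σ x) = x) :
    ∃ s : D → B, Continuous s ∧ (∀ x, π (s x) = x) ∧ (∀ x, ‖s x‖ ≤ ‖x‖) ∧
      (∀ x, ‖σ x‖ ≤ ‖x‖ → s x = σ x) ∧ ∀ x, 0 ≤ σ x → 0 ≤ s x := by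
  -- This remains a section because `‖x‖⁻¹ • x` lies in the unit ball, where `clip` is the identity.
  -- At 0 the convention `0⁻¹ = 0` is harmless, and continuity there follows from `‖s x‖ ≤ ‖x‖`.
  let s : D → B := fun x => ‖x‖ • CFC.clip (‖x‖⁻¹ • σ x)
  have hsmul : ∀ (r : ℝ) (b : B), π (r • b) = r • π b := fun r b => by
    simpa only [Complex.coe_smul] using map_smul π (r : ℂ) b
  have hs₀ : s 0 = 0 := by simp [s]
  have hle : ∀ x, ‖s x‖ ≤ ‖x‖ := fun x => by
    rw [norm_smul, norm_norm]
    exact mul_le_of_le_one_right (norm_nonneg x) (CFC.norm_clip_le_one _)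
  refine ⟨s, continuous_iff_continuousAt.2 fun x => ?_, fun x => ?_, hle, fun x hx => ?_,
    fun x hx => ?_⟩
  · by_cases hx : x = 0
    · subst hx
      rw [ContinuousAt, hs₀]
      exact squeeze_zero_norm hle (by simpa using (continuous_norm (E := D)).tendsto 0)
    · have hn : ContinuousAt (fun x : D => ‖x‖) x := continuous_norm.continuousAt
      exact hn.smul (CFC.continuous_clip.continuousAt.comp
        ((hn.inv₀ (norm_ne_zero_iff.2 hx)).smul hσ.continuousAt))
  · by_cases hx : x = 0
    · rw [hx, hs₀, map_zero]
    · have hn := norm_ne_zero_iff.2 hx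
      rw [hsmul, map_cfcClip, hsmul, hπσ, CFC.clip_of_norm_le_one, smul_inv_smul₀ hn]
      rw [norm_smul, norm_inv, norm_norm, inv_mul_cancel₀ hn]
  · by_cases h : x = 0
    · rw [h, hs₀]
      rw [h, norm_zero, norm_le_zero_iff] at hx
      exact hx.symm
    · have hn := norm_ne_zero_iff.2 h
      simp only [s]
      rw [CFC.clip_of_norm_le_one, smul_inv_smul₀ hn]
      rw [norm_smul, norm_inv, norm_norm]
      exact inv_mul_le_one_of_le₀ hx (norm_nonneg x)
  · exact smul_nonneg (norm_nonneg x)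
      (CFC.clip_nonneg (smul_nonneg (inv_nonneg.2 (norm_nonneg x)) hx))

/-- A partial continuous section on a closed set extends to a continuous section which is
contractive if the given one is, and positive if the given one is. -/
theorem exists_continuous_section_eqOn_norm_le_nonneg (π : B →⋆ₙₐ[ℂ] D)
    (hπ : Function.Surjective π) {E : Set D} (hE : IsClosed E) {f : D → B}
    (hf : ContinuousOn f E) (hπf : ∀ x ∈ E, π (f x) = x) :
    ∃ s : D → B, Continuous s ∧ (∀ x, π (s x) = x) ∧ EqOn s f E ∧
      ((∀ x ∈ E, ‖f x‖ ≤ ‖x‖) → ∀ x, ‖s x‖ ≤ ‖x‖) ∧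
      ((∀ x ∈ E, 0 ≤ x → 0 ≤ f x) → ∀ x, 0 ≤ x → 0 ≤ s x) := by
  obtain ⟨σ, hσ, hπσ, hσf, hσ₀⟩ : ∃ s : D → B, Continuous s ∧ (∀ x, π (s x) = x) ∧
      EqOn s f E ∧ ((∀ x ∈ E, 0 ≤ x → 0 ≤ f x) → ∀ x, 0 ≤ x → 0 ≤ s x) := by
    by_cases hf₀ : ∀ x ∈ E, 0 ≤ x → 0 ≤ f x
    · obtain ⟨s, hs, hπs, hsf, hs₀⟩ := exists_continuous_section_eqOn_nonneg π hπ hE hf hπf hf₀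
      exact ⟨s, hs, hπs, hsf, fun _ => hs₀⟩
    · obtain ⟨s, hs, hπs, hsf⟩ := exists_continuous_section_eqOn π hπ hE hf hπf
      exact ⟨s, hs, hπs, hsf, fun h => absurd h hf₀⟩
  by_cases hf₁ : ∀ x ∈ E, ‖f x‖ ≤ ‖x‖
  · obtain ⟨s, hs, hπs, hs₁, hsσ, hs₀⟩ := exists_contractive_section π hσ hπσ
    refine ⟨s, hs, hπs, fun x hx => ?_, fun _ => hs₁, fun h x hx => hs₀ x (hσ₀ h x hx)⟩
    rw [hsσ x (by rw [hσf hx]; exact hf₁ x hx), hσf hx]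
  · exact ⟨σ, hσ, hπσ, hσf, fun h => absurd h hf₁, hσ₀⟩

/-- A partial continuous section on a closed set extends to a continuous section which inherits
contractivity, compatibility with the involution, and positivity. -/
theorem exists_continuous_section_eqOn_norm_le_star_nonneg (π : B →⋆ₙₐ[ℂ] D)
    (hπ : Function.Surjective π) {E : Set D} (hE : IsClosed E) {f : D → B}
    (hf : ContinuousOn f E) (hπf : ∀ x ∈ E, π (f x) = x) :
    ∃ s : D → B, Continuous s ∧ (∀ x, π (s x) = x) ∧ EqOn s f E ∧
      ((∀ x ∈ E, ‖f x‖ ≤ ‖x‖) → ∀ x, ‖s x‖ ≤ ‖x‖) ∧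
      ((∀ x ∈ E, star x ∈ E → f (star x) = star (f x)) → ∀ x, s (star x) = star (s x)) ∧
      ((∀ x ∈ E, 0 ≤ x → 0 ≤ f x) → ∀ x, 0 ≤ x → 0 ≤ s x) := by
  classical
  by_cases hf' : ∀ x ∈ E, star x ∈ E → f (star x) = star (f x)
  swap
  · obtain ⟨s, hs, hπs, hsf, hs₁, hs₀⟩ :=
      exists_continuous_section_eqOn_norm_le_nonneg π hπ hE hf hπf
    exact ⟨s, hs, hπs, hsf, hs₁, fun h => absurd h hf', hs₀⟩
  -- The two prescriptions agree on E ∩ E* by `hf'`. Without the values on E*, averaging could alter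
  -- the section on `E`.
  let g : D → B := fun x => if x ∈ E then f x else star (f (star x))
  let E' : Set D := star ⁻¹' E
  have hE' : IsClosed E' := hE.preimage continuous_star
  have hgf : EqOn g f E := fun x hx => if_pos hx
  have hgf' : EqOn g (fun x => star (f (star x))) E' := fun x hx => by
    by_cases h : x ∈ E
    · have := hf' x h hx
      simp only [g, if_pos h, this, star_star]
    · exact if_neg h
  have hf'c : ContinuousOn (fun x => star (f (star x))) E' :=
    continuous_star.comp_continuousOn (hf.comp continuous_star.continuousOn fun _ h => h)
  obtain ⟨σ, hσ, hπσ, hσg, hσ₁, hσ₀⟩ := exists_continuous_section_eqOn_norm_le_nonneg π hπ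
    (hE.union hE') ((hf.congr hgf).union_of_isClosed (hf'c.congr hgf') hE hE') (by
      rintro x (hx | hx)
      · rw [hgf hx, hπf x hx]
      · rw [hgf' hx, map_star, hπf _ hx, star_star])
  have hhalf : ∀ {A : Type _} [AddCommGroup A] [Module ℂ A] (a : A),
      (2⁻¹ : ℂ) • (a + a) = a := fun a => by
    rw [← two_smul ℂ a, inv_smul_smul₀ two_ne_zero]
  have hstar2 : star (2⁻¹ : ℂ) = 2⁻¹ := by simp
  refine ⟨fun x => (2⁻¹ : ℂ) • (σ x + star (σ (star x))), by fun_prop, fun x => ?_,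
    fun x hx => ?_, fun h x => ?_, fun _ x => ?_, fun h x hx => ?_⟩
  · rw [map_smul, map_add, map_star, hπσ, hπσ, star_star]
    rw [← two_smul ℂ x, inv_smul_smul₀ two_ne_zero]
  · have hx' : star x ∈ E' := by rwa [mem_preimage, star_star]
    simp only [hσg (Or.inl hx), hσg (Or.inr hx'), hgf hx, hgf' hx', star_star]
    exact hhalf _
  · have hσ₁' := hσ₁ (by
      rintro y (hy | hy)
      · rw [hgf hy]; exact h y hy
      · rw [hgf' hy, norm_star, ← norm_star y]; exact h _ hy)
    have h₁ := hσ₁' x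
    have h₂ := hσ₁' (star x)
    rw [norm_star] at h₂
    have h₃ := norm_add_le (σ x) (star (σ (star x)))
    rw [norm_star] at h₃
    rw [norm_smul, norm_inv, RCLike.norm_ofNat]
    linarith
  · simp only [star_star, star_smul, star_add, hstar2, add_comm]
  -- For positive `x` both averaged terms equal `σ x`.
  · have hsx : star x = x := hx.isSelfAdjoint.star_eq
    have hσx : 0 ≤ σ x := hσ₀ (by
      rintro y (hy | hy) hy₀
      · rw [hgf hy]; exact h y hy hy₀
      · rw [hgf' hy]
        exact star_nonneg_iff.2 (h _ hy (star_nonneg_iff.2 hy₀))) x hx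
    simp only [hsx, hσx.isSelfAdjoint.star_eq]
    rw [hhalf]
    exact hσx

/-- `exists_continuous_section_eqOn_norm_le_star_nonneg` for a section defined on a subtype. -/
theorem exists_continuous_section_extending (π : B →⋆ₙₐ[ℂ] D)
    (hπ : Function.Surjective π) {E : Set D} (hE : IsClosed E) (s₀ : E → B)
    (hs₀ : Continuous s₀) (hπs₀ : ∀ x : E, π (s₀ x) = x) :
    ∃ s : D → B, Continuous s ∧ (∀ x : D, π (s x) = x) ∧ (∀ x : E, s x = s₀ x) ∧
      ((∀ x : E, ‖s₀ x‖ ≤ ‖(x : D)‖) → ∀ x : D, ‖s x‖ ≤ ‖x‖) ∧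
      ((∀ x y : E, (y : D) = star (x : D) → s₀ y = star (s₀ x)) →
        ∀ x : D, s (star x) = star (s x)) ∧
      ((∀ x : E, 0 ≤ (x : D) → 0 ≤ s₀ x) → ∀ x : D, 0 ≤ x → 0 ≤ s x) := by
  let f : D → B := Function.extend Subtype.val s₀ 0
  have hf : ∀ x : E, f x = s₀ x := Subtype.val_injective.extend_apply s₀ 0
  obtain ⟨s, hs, hπs, hsf, h₁, h₂, h₃⟩ :=
    exists_continuous_section_eqOn_norm_le_star_nonneg π hπ hE (f := f)
      (continuousOn_iff_continuous_domRestrict.2 (hs₀.congr fun x => (hf x).symm))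
      (fun x hx => by rw [hf ⟨x, hx⟩]; exact hπs₀ ⟨x, hx⟩)
  refine ⟨s, hs, hπs, fun x => (hsf x.2).trans (hf x), fun h => h₁ fun x hx => ?_,
    fun h => h₂ fun x hx hx' => ?_, fun h => h₃ fun x hx hx' => ?_⟩
  · rw [hf ⟨x, hx⟩]; exact h ⟨x, hx⟩
  · rw [hf ⟨x, hx⟩, hf ⟨star x, hx'⟩]; exact h ⟨x, hx⟩ ⟨star x, hx'⟩ rfl
  · rw [hf ⟨x, hx⟩]; exact h ⟨x, hx⟩ hx'

end NonUnitalStarAlgHom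

/-- The unital case: a section can be extended to a section that is unital, provided that the unit
is not in the domain of definition or is mapped to the unit. -/
theorem NonUnitalStarAlgHom.exists_continuous_unital_section_extending {B D : Type*}
    [CStarAlgebra B] [PartialOrder B] [StarOrderedRing B]
    [CStarAlgebra D] [PartialOrder D] [StarOrderedRing D] (π : B →⋆ₙₐ[ℂ] D)
    (hπ : Function.Surjective π) {E : Set D} (hE : IsClosed E) (hED : E.Nonempty ∨ Nontrivial D)
    (s₀ : E → B) (hs₀ : Continuous s₀) (hπs₀ : ∀ x : E, π (s₀ x) = x) :
    ∃ s : D → B, Continuous s ∧ (∀ x : D, π (s x) = x) ∧ (∀ x : E, s x = s₀ x) ∧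
      ((∀ x : E, (x : D) = 1 → s₀ x = 1) → s 1 = 1) ∧
      ((∀ x : E, ‖s₀ x‖ ≤ ‖(x : D)‖) → ∀ x : D, ‖s x‖ ≤ ‖x‖) ∧
      ((∀ x y : E, (y : D) = star (x : D) → s₀ y = star (s₀ x)) →
        ∀ x : D, s (star x) = star (s x)) ∧
      ((∀ x : E, 0 ≤ (x : D) → 0 ≤ s₀ x) → ∀ x : D, 0 ≤ x → 0 ≤ s x) := by
  classical
  by_cases h1 : (1 : D) ∈ E
  · obtain ⟨s, hs, hπs, hss₀, h⟩ := exists_continuous_section_extending π hπ hE s₀ hs₀ hπs₀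
    exact ⟨s, hs, hπs, hss₀, fun h' => (hss₀ ⟨1, h1⟩).trans (h' ⟨1, h1⟩ rfl), h⟩
  -- Both units need norm 1: if `D = 0`, contractivity would force `s 1 = s 0 = 0`.
  have hD : Nontrivial D := by
    refine hED.elim (fun ⟨x, hx⟩ => ?_) id
    exact ⟨⟨x, 1, fun h => h1 (h ▸ hx)⟩⟩
  have hπ1 : π 1 = 1 := by
    obtain ⟨b, hb⟩ := hπ 1
    rw [← mul_one (π 1), ← hb, ← map_mul, one_mul]
  have hB : Nontrivial B := hπ.nontrivial
  -- Only the values on E ∪ {1} matter. Adjoining 1 ↦ 1 preserves every property, as 1 is positive,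
  -- selfadjoint and of norm 1.
  let f : D → B := fun x => if hx : x ∈ E then s₀ ⟨x, hx⟩ else 1
  have hf : ∀ x : E, f x = s₀ x := fun x => dif_pos x.2
  have hf1 : f 1 = 1 := dif_neg h1
  have hfE : ContinuousOn f E :=
    continuousOn_iff_continuous_domRestrict.2 (hs₀.congr fun x => (hf x).symm)
  obtain ⟨s, hs, hπs, hsf, h₁, h₂, h₃⟩ :=
    exists_continuous_section_eqOn_norm_le_star_nonneg π hπ (hE.union isClosed_singleton)
      (hfE.union_of_isClosed (continuousOn_singleton f 1) hE isClosed_singleton) (by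
        rintro x (hx | rfl)
        · rw [hf ⟨x, hx⟩]; exact hπs₀ ⟨x, hx⟩
        · rw [hf1, hπ1])
  refine ⟨s, hs, hπs, fun x => (hsf (Or.inl x.2)).trans (hf x),
    fun _ => (hsf (Or.inr rfl)).trans hf1, fun h => h₁ ?_, fun h => h₂ ?_, fun h => h₃ ?_⟩
  · rintro x (hx | rfl)
    · rw [hf ⟨x, hx⟩]; exact h ⟨x, hx⟩
    · rw [hf1, CStarRing.norm_one, CStarRing.norm_one]
  · rintro x (hx | rfl) hx'
    · rcases hx' with hx' | hx'
      · rw [hf ⟨x, hx⟩, hf ⟨star x, hx'⟩]; exact h ⟨x, hx⟩ ⟨star x, hx'⟩ rfl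
      · rw [Set.mem_singleton_iff, star_eq_iff_star_eq, star_one] at hx'
        exact absurd (hx' ▸ hx) h1
    · rw [star_one, hf1, star_one]
  · rintro x (hx | rfl) hx'
    · rw [hf ⟨x, hx⟩]; exact h ⟨x, hx⟩ hx'
    · rw [hf1]; exact zero_le_one

/-- Part 1: arbitrary (not necessarily unital) C⋆-algebras. Part 2: unital C⋆-algebras, with unitality
of the section as an additional property. In both parts one and the same extension `s` inherits every
property in the list that `s₀` has, so the claim covers every combination of the properties.
For `s₀`, which is defined on `E` only, each property is required where it makes sense. -/
theorem theorem3p5 :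
    (∀ (B D : Type*)
      [NonUnitalCStarAlgebra B] [PartialOrder B] [StarOrderedRing B]
      [NonUnitalCStarAlgebra D] [PartialOrder D] [StarOrderedRing D]
      (π : B →⋆ₙₐ[ℂ] D) (_ : Function.Surjective π)
      (E : Set D) (_ : IsClosed E)
      (s₀ : E → B) (_ : Continuous s₀) (_ : ∀ x : E, π (s₀ x) = x),
      ∃ s : D → B, Continuous s ∧ (∀ x : D, π (s x) = x) ∧ (∀ x : E, s x = s₀ x) ∧
        ((∀ x : E, ‖s₀ x‖ ≤ ‖(x : D)‖) → ∀ x : D, ‖s x‖ ≤ ‖x‖) ∧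
        ((∀ x y : E, (y : D) = star (x : D) → s₀ y = star (s₀ x)) →
          ∀ x : D, s (star x) = star (s x)) ∧
        ((∀ x : E, 0 ≤ (x : D) → 0 ≤ s₀ x) → ∀ x : D, 0 ≤ x → 0 ≤ s x)) ∧
    (∀ (B D : Type*)
      [CStarAlgebra B] [PartialOrder B] [StarOrderedRing B]
      [CStarAlgebra D] [PartialOrder D] [StarOrderedRing D]
      (π : B →⋆ₙₐ[ℂ] D) (_ : Function.Surjective π)
      (E : Set D) (_ : IsClosed E) (_ : E.Nonempty ∨ Nontrivial D)
      (s₀ : E → B) (_ : Continuous s₀) (_ : ∀ x : E, π (s₀ x) = x),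
      ∃ s : D → B, Continuous s ∧ (∀ x : D, π (s x) = x) ∧ (∀ x : E, s x = s₀ x) ∧
        ((∀ x : E, (x : D) = 1 → s₀ x = 1) → s 1 = 1) ∧
        ((∀ x : E, ‖s₀ x‖ ≤ ‖(x : D)‖) → ∀ x : D, ‖s x‖ ≤ ‖x‖) ∧
        ((∀ x y : E, (y : D) = star (x : D) → s₀ y = star (s₀ x)) →
          ∀ x : D, s (star x) = star (s x)) ∧
        ((∀ x : E, 0 ≤ (x : D) → 0 ≤ s₀ x) → ∀ x : D, 0 ≤ x → 0 ≤ s x)) := by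
  refine ⟨?_, ?_⟩
  · intro B D _ _ _ _ _ _ π hπ E hE s₀ hs₀ hπs₀
    exact π.exists_continuous_section_extending hπ hE s₀ hs₀ hπs₀
  · intro B D _ _ _ _ _ _ π hπ E hE hED s₀ hs₀ hπs₀
    exact π.exists_continuous_unital_section_extending hπ hE hED s₀ hs₀ hπs₀
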